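/- Let $N$ be a lattice of finite rank $r\ge 0$ and $N_{\mathbb R}=N\otimes\mathbb R$. For a subset $S\subseteq N_{\mathbb R}$ let $L(S)$ be the linear subspace spanned by the differences of elements of $S$, and let $L_N(S)=L(S)\cap N$. **Tropical curves.** Consider a finite graph $\Gamma$ (loops and multiple edges allowed) with vertex set $\Gamma^{[0]}$, compact edges $\Gamma_c^{[1]}$, and non-compact edges $E_j$, each with exactly one vertex $\partial E_j$, labelled bijectively by a finite set $I$. It carries weights $w\ge 0$ (integers) on the edges and genera $g(V)\in\mathbb Z_{\ge0}$ on the vertices, such that vertices of valence $1$ or $2$ have positive genus. A (parameterized) tropical curve is such a graph together with a continuous map $h:\Gamma\to N_{\mathbb R}$ that contracts every edge of weight $0$ to a point, embeds every edge of positive weight properly into an affine line of rational slope, and is balanced: $\sum_{E\ni V}w(E)u_{(V,E)}=0$ at each vertex $V$, where $u_{(V,E)}\in N$ is the primitive vector pointing from $h(V)$ into $h(E)$ ($0$ if $E$ is contracted). The curve may be disconnected unless stated otherwise. Its genus is $b_1(\Gamma)+\sum_Vg(V)$ and its degree is $\Delta:I\to N$, $\Delta(j)=w(E_j)u_{E_j}$.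 Put $\mathrm{ov}(V)=\mathrm{val}(V)+3g(V)-3$. **Conditions.** Let $\mathbf A=(A_j)_{j\in I}$ be a tuple of affine subspaces of $N_{\mathbb R}$, and let $\Psi=(s_j)_{j\in I^\circ}$ be non-negative integers, where $I^\circ=\{j\in I: w(E_j)=0\}$. The curve matches $\mathbf A$ if $h(E_j)\subseteq A_j$ for all $j$, and satisfies $\Psi$ if $\mathrm{ov}(V)\ge\sum_{j\in I^\circ,\,E_j\ni V}s_j$ for every vertex $V$. Let $\mathfrak T_{g,\Delta}(\mathbf A,\Psi)$ be the set of connected tropical curves of genus $g$ and degree $\Delta$ matching $\mathbf A$ and satisfying $\Psi$. **Rigidity.** Let $F\subseteq N_{\mathbb R}^{\Gamma^{[0]}}$ be the set of vertex positions of all curves of the same type as $\Gamma$ (same graph, weights, genera, labels, and vectors $u_{(V,E)}$), and let $d=\#I+(r-3)(1-g)-\sum_V\mathrm{ov}(V)$. A curve $\Gamma\in\mathfrak T_{g,\Delta}(\mathbf A,\Psi)$ is rigid if: it has no contracted loop and no vertex of positive genus; $\dim F=d$; $\sum_j\mathrm{codim}\,A_j=d$; and $\mathbf A$ is generic for $\Gamma$,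 meaning that the set of translates of $\mathbf A$ matched by curves of the type of $\Gamma$ (the image of $F$ in $\prod_jN_{\mathbb R}/L(A_j)$ under $H\mapsto (H_{\partial E_j})_j$) lies in no proper affine subspace of $\prod_j N_{\mathbb R}/L(A_j)$. **Multiplicity.** Choose an ordering $\partial^-E,\partial^+E$ of the two ends of each compact edge. The multiplicity of a (possibly disconnected) tropical curve with respect to constraints $\mathbf A$ is $$\mathrm{Mult}_{\mathbf A}(\Gamma)=\mathrm{ind}(\Phi)\prod_{E\in\Gamma^{[1]}_c}w(E),$$ where $\Phi$ is the map $$\prod_{V\in\Gamma^{[0]}}N\to\prod_{E\in\Gamma_c^{[1]}}N/L_N(h(E))\times\prod_{j\in I}N/L_N(A_j),\qquad H\mapsto\big((H_{\partial^+E}-H_{\partial^-E})_E,(H_{\partial E_j})_j\big),$$ and $\mathrm{ind}(\Phi)$ is the index of its image (taken to be $0$ if it is infinite). **Proposition.** Let $\Gamma$ be a rigid tropical curve in $\mathfrak T_{g,\Delta}(\mathbf A,\Psi)$, of any genus $g$. Suppose that for some $i\in I^\circ$ the constraint $A_i$ is a single point of $N_{\mathbb R}$. Let $V_i$ be the vertex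 of $E_i$ and let $I_i$ be the set of edges $E\ne E_i$ (compact or not) containing $V_i$. Let $\Gamma_i$ be the (possibly disconnected) tropical curve obtained from $\Gamma$ as follows: delete $E_i$ and $V_i$; close up each $E\in I_i$ at its open end by a new vertex $V_E$ of genus $0$, placed at the point $h(V_i)$; attach at $V_E$ a new unbounded edge of weight $w(E)$ that extends $E$ beyond $V_E$ to infinity (and is contracted if $w(E)=0$); and attach at $V_E$ a new contracted edge $E^\circ$. All remaining edges, directions, weights, genera and positions are unchanged; in particular each compact $E\in I_i$ remains a compact edge, now ending at $V_E$, and each non-compact $E_j\in I_i$ remains a non-compact edge, now with vertex $V_E$. Let $\mathbf A'$ be the following constraints on $\Gamma_i$: each non-compact edge $E_j$ with $j\ne i$ keeps its constraint $A_j$, each new unbounded edge extending some $E\in I_i$ gets the trivial constraint $N_{\mathbb R}$, and each new contracted edge $E^\circ$ gets the point condition $\{h(V_i)\}$. Then $$\mathrm{Mult}_{\mathbf A}(\Gamma)=\mathrm{Mult}_{\mathbf A'}(\Gamma_i).$$ -/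

import Mathlib

open scoped TensorProduct

noncomputable section

namespace TropicalSplit

/-- The real vector space spanned by the lattice `N`. -/
abbrev RealSpan (N : Type*) [AddCommGroup N] : Type _ := ℝ ⊗[ℤ] N

/-- The canonical map from the lattice `N` to its real span. -/
def toReal (N : Type*) [AddCommGroup N] : N →ₗ[ℤ] RealSpan N :=
  TensorProduct.mk ℤ ℝ N 1

/-- For a subset `S` of the real span, the lattice points of the linear subspace spanned by all
differences `x - y` with `x, y ∈ S`. -/
def latticeSpan {N : Type*} [AddCommGroup N] (S : Set (RealSpan N)) : Submodule ℤ N :=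
  ((vectorSpan ℝ S).restrictScalars ℤ).comap (toReal N)

/-- Primitive (nonzero) lattice vectors. -/
def IsPrimitive {N : Type*} [AddCommGroup N] (u : N) : Prop :=
  u ≠ 0 ∧ ∀ (k : ℕ) (v : N), u = k • v → k = 1

/-- A parameterized tropical curve in the real span of `N`, possibly disconnected, with vertices
`V`, compact edges `C` and non-compact edges labelled by `I`.

The continuous map `h` to the real span is recorded by the data that determine it up to
isomorphism: the images `pos` of the vertices, and the directions of the edges.  A compact edge
maps to the segment joining the images of its two vertices; a non-compact edge maps to the ray
(or point) starting at the image of its vertex in the given direction. -/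
structure TropCurve (N V C I : Type*) [AddCommGroup N] [DecidableEq V] [Fintype C]
    [Fintype I] where
  /-- The first vertex of a compact edge. -/
  src : C → V
  /-- The second vertex of a compact edge. -/
  tgt : C → V
  /-- The vertex of a non-compact edge. -/
  bdry : I → V
  /-- Weights of the compact edges. -/
  wt : C → ℕ
  /-- Weights of the non-compact edges. -/
  wtEnd : I → ℕ
  /-- The genus function on the vertices. -/
  genusAt : V → ℕ
  /-- The primitive vector of a compact edge, pointing from `src` to `tgt` (zero if the edge is
  contracted); the vector of the opposite flag is its negative. -/
  dir : C → N
  /-- The primitive vector of a non-compact edge, pointing away from its vertex (zero if the edge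
  is contracted). -/
  dirEnd : I → N
  /-- The images of the vertices. -/
  pos : V → RealSpan N
  stable : ∀ v,
    ((∑ e, if src e = v then 1 else 0) + (∑ e, if tgt e = v then 1 else 0)
      + (∑ j, if bdry j = v then 1 else 0) = 1 ∨
     (∑ e, if src e = v then 1 else 0) + (∑ e, if tgt e = v then 1 else 0)
      + (∑ j, if bdry j = v then 1 else 0) = 2) → 0 < genusAt v
  dir_zero : ∀ e, wt e = 0 → dir e = 0
  dir_primitive : ∀ e, 0 < wt e → IsPrimitive (dir e)
  dirEnd_zero : ∀ j, wtEnd j = 0 → dirEnd j = 0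
  dirEnd_primitive : ∀ j, 0 < wtEnd j → IsPrimitive (dirEnd j)
  /-- A compact edge of positive weight is a nondegenerate segment in direction `dir e`; a compact
  edge of weight zero is contracted to a point (as then `dir e = 0`). -/
  pos_edge : ∀ e, ∃ t : ℝ, 0 < t ∧ pos (tgt e) - pos (src e) = t • toReal N (dir e)
  /-- The balancing condition. -/
  balanced : ∀ v,
    (∑ e, if src e = v then wt e • dir e else 0) + (∑ e, if tgt e = v then wt e • (-dir e) else 0)
      + (∑ j, if bdry j = v then wtEnd j • dirEnd j else 0) = 0

namespace TropCurve

variable {N V C I : Type*} [AddCommGroup N] [DecidableEq V] [Fintype C] [Fintype I]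

/-- The valence of a vertex (a loop counts twice). -/
def valence (Γ : TropCurve N V C I) (v : V) : ℕ :=
  (∑ e, if Γ.src e = v then 1 else 0) + (∑ e, if Γ.tgt e = v then 1 else 0)
    + (∑ j, if Γ.bdry j = v then 1 else 0)

/-- The over-valence of a vertex. -/
def overValence (Γ : TropCurve N V C I) (v : V) : ℤ :=
  (Γ.valence v : ℤ) + 3 * (Γ.genusAt v : ℤ) - 3

/-- Two vertices are adjacent if a compact edge joins them. -/
def Adj (Γ : TropCurve N V C I) (v v' : V) : Prop :=
  ∃ e, Γ.src e = v ∧ Γ.tgt e = v'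

/-- The set of connected components. -/
abbrev Components (Γ : TropCurve N V C I) : Type _ := Quot Γ.Adj

/-- The underlying graph is connected (and has a vertex). -/
def Connected (Γ : TropCurve N V C I) : Prop := Nat.card Γ.Components = 1

/-- The genus: first Betti number of the graph plus the sum of the genera of the vertices. -/
def genus (Γ : TropCurve N V C I) [Fintype V] : ℤ :=
  ((Fintype.card C : ℤ) - Fintype.card V + Nat.card Γ.Components) + ∑ v, (Γ.genusAt v : ℤ)

/-- The degree: the weighted directions of the non-compact edges. -/
def degree (Γ : TropCurve N V C I) : I → N := fun j => Γ.wtEnd j • Γ.dirEnd j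

/-- The image of a compact edge. -/
def edgeImage (Γ : TropCurve N V C I) (e : C) : Set (RealSpan N) :=
  segment ℝ (Γ.pos (Γ.src e)) (Γ.pos (Γ.tgt e))

/-- The image of a non-compact edge. -/
def endImage (Γ : TropCurve N V C I) (j : I) : Set (RealSpan N) :=
  {x | ∃ t : ℝ, 0 ≤ t ∧ x = Γ.pos (Γ.bdry j) + t • toReal N (Γ.dirEnd j)}

/-- The curve matches the affine constraint `A`. -/
def Matches (Γ : TropCurve N V C I) (A : I → AffineSubspace ℝ (RealSpan N)) : Prop :=
  ∀ j, Γ.endImage j ⊆ (A j : Set (RealSpan N))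

/-- The curve satisfies the psi-class conditions `Ψ`, which are attached to the contracted
non-compact edges. -/
def SatisfiesPsi (Γ : TropCurve N V C I) (Ψ : {j : I // Γ.wtEnd j = 0} → ℕ) : Prop :=
  ∀ v, ((∑ j, if Γ.bdry j.1 = v then Ψ j else 0 : ℕ) : ℤ) ≤ Γ.overValence v

/-- The face of the moduli space given by the type of `Γ`: all positions of the vertices for which
the curve has the same combinatorial type and the same edge directions. -/
def face (Γ : TropCurve N V C I) : Set (V → RealSpan N) :=
  {H | ∀ e, ∃ t : ℝ, 0 < t ∧ H (Γ.tgt e) - H (Γ.src e) = t • toReal N (Γ.dir e)}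

/-- The expected dimension of the face. -/
def expectedDim (Γ : TropCurve N V C I) [Fintype V] : ℤ :=
  (Fintype.card I : ℤ) + ((Module.finrank ℤ N : ℤ) - 3) * (1 - Γ.genus) - ∑ v, Γ.overValence v

/-- Non-superabundance: no contracted loops, no vertices of positive genus, and the face has the
expected dimension. -/
structure NonSuperabundant (Γ : TropCurve N V C I) [Fintype V] : Prop where
  no_contracted_loop : ∀ e, Γ.wt e = 0 → Γ.src e ≠ Γ.tgt e
  genus_zero_vertices : ∀ v, Γ.genusAt v = 0
  dim_eq : (Module.finrank ℝ (vectorSpan ℝ Γ.face) : ℤ) = Γ.expectedDim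

/-- The evaluation of vertex positions at the non-compact edges, with values in the space of
translates of the constraints `A`. -/
def eval (Γ : TropCurve N V C I) (A : I → AffineSubspace ℝ (RealSpan N)) (H : V → RealSpan N) :
    ∀ j, RealSpan N ⧸ (A j).direction :=
  fun j => (A j).direction.mkQ (H (Γ.bdry j))

/-- The genericity of `A` that matters for a curve `Γ` matching `A`: the set of all translates of
`A` that are matched by some curve of the type of `Γ` is not contained in a proper affine subspace
of the space of translates.  (A tuple `A` outside finitely many such lower-dimensional sets, one for
each type, has this property for all curves of the given genus and degree that match it.) -/
def GenericFor (Γ : TropCurve N V C I) (A : I → AffineSubspace ℝ (RealSpan N)) : Prop :=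
  vectorSpan ℝ (Γ.eval A '' Γ.face) = ⊤

/-- `Γ` is a (connected) tropical curve of genus `g` and degree `Δ` that matches `A` and
satisfies `Ψ`. -/
structure InModuli (Γ : TropCurve N V C I) [Fintype V] (g : ℕ) (Δ : I → N)
    (A : I → AffineSubspace ℝ (RealSpan N)) (Ψ : {j : I // Γ.wtEnd j = 0} → ℕ) : Prop where
  connected : Γ.Connected
  genus_eq : Γ.genus = g
  degree_eq : Γ.degree = Δ
  isMatch : Γ.Matches A
  psi : Γ.SatisfiesPsi Ψ

/-- `Γ` is a rigid tropical curve of genus `g` and degree `Δ` with respect to `A` and `Ψ`. -/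
structure IsRigid (Γ : TropCurve N V C I) [Fintype V] (g : ℕ) (Δ : I → N)
    (A : I → AffineSubspace ℝ (RealSpan N)) (Ψ : {j : I // Γ.wtEnd j = 0} → ℕ) : Prop
    extends Γ.InModuli g Δ A Ψ where
  nonSuperabundant : Γ.NonSuperabundant
  generic : Γ.GenericFor A
  codim_eq : ((∑ j, Module.finrank ℝ (RealSpan N ⧸ (A j).direction) : ℕ) : ℤ) = Γ.expectedDim

/-- The map of lattices whose index enters the multiplicity. -/
def latticeMap (Γ : TropCurve N V C I) (A : I → AffineSubspace ℝ (RealSpan N)) :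
    (V → N) →ₗ[ℤ] (∀ e : C, N ⧸ latticeSpan (Γ.edgeImage e)) ×
      (∀ j : I, N ⧸ latticeSpan (A j : Set (RealSpan N))) :=
  LinearMap.prod
    (LinearMap.pi fun e => (latticeSpan (Γ.edgeImage e)).mkQ ∘ₗ
      (LinearMap.proj (R := ℤ) (φ := fun _ : V => N) (Γ.tgt e)
        - LinearMap.proj (R := ℤ) (φ := fun _ : V => N) (Γ.src e)))
    (LinearMap.pi fun j => (latticeSpan (A j : Set (RealSpan N))).mkQ ∘ₗ
      LinearMap.proj (R := ℤ) (φ := fun _ : V => N) (Γ.bdry j))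

/-- The index of the lattice map (`0` if it is infinite). -/
def latticeIndex (Γ : TropCurve N V C I) (A : I → AffineSubspace ℝ (RealSpan N)) : ℕ :=
  (LinearMap.range (Γ.latticeMap A)).toAddSubgroup.index

/-- The multiplicity of `Γ` with respect to the constraints `A`. -/
def mult (Γ : TropCurve N V C I) (A : I → AffineSubspace ℝ (RealSpan N)) : ℕ :=
  Γ.latticeIndex A * ∏ e, Γ.wt e

section Split

/-- The edges other than `E_i` at the vertex `V_i` of the non-compact edge `E_i`. -/
abbrev Star (Γ : TropCurve N V C I) (i : I) : Type _ :=
  {e : C // Γ.src e = Γ.bdry i ∨ Γ.tgt e = Γ.bdry i} ⊕ {j : I // j ≠ i ∧ Γ.bdry j = Γ.bdry i}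

/-- The weight of an edge at `V_i`. -/
def starWt (Γ : TropCurve N V C I) (i : I) : Γ.Star i → ℕ
  | Sum.inl e => Γ.wt e.1
  | Sum.inr j => Γ.wtEnd j.1

/-- The primitive direction in which an edge at `V_i` is extended beyond `V_i`. -/
def starDir (Γ : TropCurve N V C I) (i : I) : Γ.Star i → N
  | Sum.inl e => if Γ.tgt e.1 = Γ.bdry i then Γ.dir e.1 else -Γ.dir e.1
  | Sum.inr j => -Γ.dirEnd j.1

/-- The vertices of the split curve: the vertices other than `V_i`, and one new vertex `V_E` for
each other edge `E` at `V_i`. -/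
abbrev SplitVertex (Γ : TropCurve N V C I) (i : I) : Type _ :=
  {v : V // v ≠ Γ.bdry i} ⊕ Γ.Star i

/-- The labels of the non-compact edges of the split curve: the old ones without `i`, then, for each
other edge `E` at `V_i`, the extension of `E` beyond `V_E`, and the new contracted edge at `V_E`. -/
abbrev SplitEnd (Γ : TropCurve N V C I) (i : I) : Type _ :=
  {j : I // j ≠ i} ⊕ (Γ.Star i ⊕ Γ.Star i)

/-- The first vertices of the compact edges of the split curve. -/
def splitSrc (Γ : TropCurve N V C I) (i : I) (e : C) : Γ.SplitVertex i :=
  if h : Γ.src e = Γ.bdry i then Sum.inr (Sum.inl ⟨e, Or.inl h⟩) else Sum.inl ⟨Γ.src e, h⟩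

/-- The second vertices of the compact edges of the split curve. -/
def splitTgt (Γ : TropCurve N V C I) (i : I) (e : C) : Γ.SplitVertex i :=
  if h : Γ.tgt e = Γ.bdry i then Sum.inr (Sum.inl ⟨e, Or.inr h⟩) else Sum.inl ⟨Γ.tgt e, h⟩

/-- The vertices of the non-compact edges of the split curve. -/
def splitBdry (Γ : TropCurve N V C I) (i : I) : Γ.SplitEnd i → Γ.SplitVertex i
  | Sum.inl j =>
      if h : Γ.bdry j.1 = Γ.bdry i then Sum.inr (Sum.inr ⟨j.1, j.2, h⟩)
      else Sum.inl ⟨Γ.bdry j.1, h⟩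
  | Sum.inr (Sum.inl s) => Sum.inr s
  | Sum.inr (Sum.inr s) => Sum.inr s

/-- The weights of the non-compact edges of the split curve. -/
def splitWtEnd (Γ : TropCurve N V C I) (i : I) : Γ.SplitEnd i → ℕ
  | Sum.inl j => Γ.wtEnd j.1
  | Sum.inr (Sum.inl s) => Γ.starWt i s
  | Sum.inr (Sum.inr _) => 0

/-- The primitive directions of the non-compact edges of the split curve. -/
def splitDirEnd (Γ : TropCurve N V C I) (i : I) : Γ.SplitEnd i → N
  | Sum.inl j => Γ.dirEnd j.1
  | Sum.inr (Sum.inl s) => Γ.starDir i s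
  | Sum.inr (Sum.inr _) => 0

/-- The genera of the vertices of the split curve. -/
def splitGenusAt (Γ : TropCurve N V C I) (i : I) : Γ.SplitVertex i → ℕ
  | Sum.inl v => Γ.genusAt v.1
  | Sum.inr _ => 0

/-- The positions of the vertices of the split curve. -/
def splitPos (Γ : TropCurve N V C I) (i : I) : Γ.SplitVertex i → RealSpan N
  | Sum.inl v => Γ.pos v.1
  | Sum.inr _ => Γ.pos (Γ.bdry i)

theorem toReal_injective [Module.Free ℤ N] : Function.Injective (toReal N) := by
  have h := Module.Flat.rTensor_preserves_injective_linearMap (M := N)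
    (Algebra.linearMap ℤ ℝ) (by intro a b hab; simpa using hab)
  intro a b hab
  have h2 : (LinearMap.rTensor N (Algebra.linearMap ℤ ℝ)) (1 ⊗ₜ[ℤ] a)
      = (LinearMap.rTensor N (Algebra.linearMap ℤ ℝ)) (1 ⊗ₜ[ℤ] b) := by
    have hab' : (1 : ℝ) ⊗ₜ[ℤ] a = (1 : ℝ) ⊗ₜ[ℤ] b := hab
    simp only [LinearMap.rTensor_tmul, Algebra.linearMap_apply, map_one, hab']
  simpa using congrArg (TensorProduct.lid ℤ N) (h h2)

theorem dir_loop [Module.Free ℤ N] (Γ : TropCurve N V C I) {e : C} (h : Γ.src e = Γ.tgt e) :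
    Γ.dir e = 0 := by
  obtain ⟨t, ht, he⟩ := Γ.pos_edge e
  rw [h, sub_self] at he
  have h1 := (smul_eq_zero.mp he.symm).resolve_left ht.ne'
  exact toReal_injective (by rw [h1, map_zero])

theorem IsPrimitive_neg {u : N} (h : IsPrimitive u) : IsPrimitive (-u) :=
  ⟨neg_ne_zero.mpr h.1, fun k v hv => h.2 k (-v) (by rw [smul_neg, ← hv, neg_neg])⟩

theorem splitSrc_inl (Γ : TropCurve N V C I) (i : I) (e : C) (v : {v : V // v ≠ Γ.bdry i}) :
    Γ.splitSrc i e = Sum.inl v ↔ Γ.src e = v.1 := by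
  unfold splitSrc
  split_ifs with h
  · refine iff_of_false id fun h' => ?_
    exact v.2 (h' ▸ h)
  · rw [Sum.inl.injEq, Subtype.ext_iff]

theorem splitTgt_inl (Γ : TropCurve N V C I) (i : I) (e : C) (v : {v : V // v ≠ Γ.bdry i}) :
    Γ.splitTgt i e = Sum.inl v ↔ Γ.tgt e = v.1 := by
  unfold splitTgt
  split_ifs with h
  · refine iff_of_false id fun h' => ?_
    exact v.2 (h' ▸ h)
  · rw [Sum.inl.injEq, Subtype.ext_iff]

theorem splitBdry_inl (Γ : TropCurve N V C I) (i : I) (j : {j : I // j ≠ i})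
    (v : {v : V // v ≠ Γ.bdry i}) :
    Γ.splitBdry i (Sum.inl j) = Sum.inl v ↔ Γ.bdry j.1 = v.1 := by
  simp only [splitBdry]
  split_ifs with h
  · refine iff_of_false id fun h' => ?_
    exact v.2 (h' ▸ h)
  · rw [Sum.inl.injEq, Subtype.ext_iff]

theorem splitSrc_inr (Γ : TropCurve N V C I) (i : I) (e : C)
    (s : {e : C // Γ.src e = Γ.bdry i ∨ Γ.tgt e = Γ.bdry i}) :
    Γ.splitSrc i e = Sum.inr (Sum.inl s) ↔ e = s.1 ∧ Γ.src s.1 = Γ.bdry i := by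
  unfold splitSrc
  split_ifs with h
  · rw [Sum.inr.injEq, Sum.inl.injEq, Subtype.ext_iff]
    constructor
    · rintro rfl
      exact ⟨rfl, h⟩
    · exact fun h => h.1
  · refine iff_of_false id ?_
    rintro ⟨rfl, h'⟩
    exact h h'

theorem splitTgt_inr (Γ : TropCurve N V C I) (i : I) (e : C)
    (s : {e : C // Γ.src e = Γ.bdry i ∨ Γ.tgt e = Γ.bdry i}) :
    Γ.splitTgt i e = Sum.inr (Sum.inl s) ↔ e = s.1 ∧ Γ.tgt s.1 = Γ.bdry i := by
  unfold splitTgt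
  split_ifs with h
  · rw [Sum.inr.injEq, Sum.inl.injEq, Subtype.ext_iff]
    constructor
    · rintro rfl
      exact ⟨rfl, h⟩
    · exact fun h => h.1
  · refine iff_of_false id ?_
    rintro ⟨rfl, h'⟩
    exact h h'

theorem splitSrc_inr_inr (Γ : TropCurve N V C I) (i : I) (e : C)
    (s : {j : I // j ≠ i ∧ Γ.bdry j = Γ.bdry i}) :
    Γ.splitSrc i e ≠ Sum.inr (Sum.inr s) := by
  unfold splitSrc
  split_ifs with h <;> simp

theorem splitTgt_inr_inr (Γ : TropCurve N V C I) (i : I) (e : C)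
    (s : {j : I // j ≠ i ∧ Γ.bdry j = Γ.bdry i}) :
    Γ.splitTgt i e ≠ Sum.inr (Sum.inr s) := by
  unfold splitTgt
  split_ifs with h <;> simp

theorem splitBdry_inr_inl (Γ : TropCurve N V C I) (i : I) (j : {j : I // j ≠ i})
    (s : {e : C // Γ.src e = Γ.bdry i ∨ Γ.tgt e = Γ.bdry i}) :
    Γ.splitBdry i (Sum.inl j) ≠ Sum.inr (Sum.inl s) := by
  simp only [splitBdry]
  split_ifs with h <;> simp

theorem splitBdry_inr_inr (Γ : TropCurve N V C I) (i : I) (j : {j : I // j ≠ i})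
    (s : {j : I // j ≠ i ∧ Γ.bdry j = Γ.bdry i}) :
    Γ.splitBdry i (Sum.inl j) = Sum.inr (Sum.inr s) ↔ j = ⟨s.1, s.2.1⟩ := by
  simp only [splitBdry]
  split_ifs with h
  · rw [Sum.inr.injEq, Sum.inr.injEq, Subtype.ext_iff, Subtype.ext_iff]
  · refine iff_of_false id ?_
    rintro rfl
    exact h s.2.2

theorem splitPos_src (Γ : TropCurve N V C I) (i : I) (e : C) :
    Γ.splitPos i (Γ.splitSrc i e) = Γ.pos (Γ.src e) := by
  unfold splitSrc
  split_ifs with h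
  · simp only [splitPos, h]
  · rfl

theorem splitPos_tgt (Γ : TropCurve N V C I) (i : I) (e : C) :
    Γ.splitPos i (Γ.splitTgt i e) = Γ.pos (Γ.tgt e) := by
  unfold splitTgt
  split_ifs with h
  · simp only [splitPos, h]
  · rfl

/-- Sums over the non-compact edges of the split curve at an old vertex. -/
theorem sum_splitBdry_inl {M : Type*} [AddCommMonoid M] [DecidableEq C] [DecidableEq I]
    (Γ : TropCurve N V C I) (i : I) (v : {v : V // v ≠ Γ.bdry i}) (f : Γ.SplitEnd i → M)
    (f' : I → M) (hf : ∀ j, f (Sum.inl j) = f' j.1) :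
    (∑ j, if Γ.splitBdry i j = Sum.inl v then f j else 0)
      = ∑ j, if Γ.bdry j = v.1 then f' j else 0 := by
  have h1 : ∀ s : Γ.Star i ⊕ Γ.Star i, Γ.splitBdry i (Sum.inr s) ≠ Sum.inl v := by
    rintro (s | s) <;> simp [splitBdry]
  rw [Fintype.sum_sum_type]
  simp only [h1, if_false, Finset.sum_const_zero, add_zero, splitBdry_inl, hf]
  symm
  rw [← Finset.sum_subtype (Finset.univ.erase i) (p := fun j => j ≠ i) (by simp)
    (fun j => if Γ.bdry j = v.1 then f' j else 0)]
  rw [← Finset.sum_erase Finset.univ (a := i) (by rw [if_neg (fun h => v.2 h.symm)])]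

/-- Sums over the non-compact edges of the split curve at a new vertex. -/
theorem sum_splitBdry_inr {M : Type*} [AddCommMonoid M] [DecidableEq C] [DecidableEq I]
    (Γ : TropCurve N V C I) (i : I) (s : Γ.Star i) (f : Γ.SplitEnd i → M) :
    (∑ j, if Γ.splitBdry i j = Sum.inr s then f j else 0)
      = (∑ j, if Γ.splitBdry i (Sum.inl j) = Sum.inr s then f (Sum.inl j) else 0)
        + (f (Sum.inr (Sum.inl s)) + f (Sum.inr (Sum.inr s))) := by
  have h1 : ∀ t : Γ.Star i, Γ.splitBdry i (Sum.inr (Sum.inl t)) = Sum.inr s ↔ t = s :=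
    fun t => Sum.inr.injEq t s ▸ Iff.rfl
  have h2 : ∀ t : Γ.Star i, Γ.splitBdry i (Sum.inr (Sum.inr t)) = Sum.inr s ↔ t = s :=
    fun t => Sum.inr.injEq t s ▸ Iff.rfl
  rw [Fintype.sum_sum_type, Fintype.sum_sum_type]
  simp only [h1, h2, Finset.sum_ite_eq', Finset.mem_univ, if_true]

/-- The split curve: delete `E_i` and its vertex `V_i`, close up each other edge `E` at `V_i`
by a new vertex `V_E`, extend `E` beyond `V_E` to infinity, and attach a new contracted edge
at `V_E`. -/
def split [Module.Free ℤ N] [DecidableEq C] [DecidableEq I] (Γ : TropCurve N V C I) (i : I) :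
    TropCurve N (Γ.SplitVertex i) C (Γ.SplitEnd i) where
  src := Γ.splitSrc i
  tgt := Γ.splitTgt i
  bdry := Γ.splitBdry i
  wt := Γ.wt
  wtEnd := Γ.splitWtEnd i
  genusAt := Γ.splitGenusAt i
  dir := Γ.dir
  dirEnd := Γ.splitDirEnd i
  pos := Γ.splitPos i
  stable := by
    rintro (v | s)
    · simp only [splitSrc_inl, splitTgt_inl,
        sum_splitBdry_inl Γ i v (fun _ => 1) (fun _ => 1) (fun _ => rfl)]
      exact Γ.stable v.1
    · intro h
      exfalso
      rw [sum_splitBdry_inr] at h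
      rcases s with s | s
      · have h3 : (1 : ℕ) ≤ (∑ e, if Γ.splitSrc i e = Sum.inr (Sum.inl s) then 1 else 0)
            + (∑ e, if Γ.splitTgt i e = Sum.inr (Sum.inl s) then 1 else 0) := by
          simp only [splitSrc_inr, splitTgt_inr, ite_and, Finset.sum_ite_eq', Finset.mem_univ,
            if_true]
          rcases s.2 with h | h <;> simp [h]
        omega
      · simp only [splitBdry_inr_inr, Finset.sum_ite_eq', Finset.mem_univ, if_true] at h
        omega
  dir_zero := Γ.dir_zero
  dir_primitive := Γ.dir_primitive
  dirEnd_zero := by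
    rintro (j | (e | j) | s) h
    · exact Γ.dirEnd_zero j.1 h
    · have h0 := Γ.dir_zero e.1 h
      simp only [splitDirEnd, starDir, h0, neg_zero, ite_self]
    · have h0 := Γ.dirEnd_zero j.1 h
      simp only [splitDirEnd, starDir, h0, neg_zero]
    · rfl
  dirEnd_primitive := by
    rintro (j | (e | j) | s) h
    · exact Γ.dirEnd_primitive j.1 h
    · have h0 := Γ.dir_primitive e.1 h
      simp only [splitDirEnd, starDir]
      split_ifs
      · exact h0
      · exact IsPrimitive_neg h0
    · exact IsPrimitive_neg (Γ.dirEnd_primitive j.1 h)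
    · exact absurd h (lt_irrefl 0)
  pos_edge := by
    intro e
    rw [splitPos_src, splitPos_tgt]
    exact Γ.pos_edge e
  balanced := by
    rintro (v | s)
    · simp only [splitSrc_inl, splitTgt_inl,
        sum_splitBdry_inl Γ i v (fun j => Γ.splitWtEnd i j • Γ.splitDirEnd i j)
          (fun j => Γ.wtEnd j • Γ.dirEnd j) (fun _ => rfl)]
      exact Γ.balanced v.1
    · rw [sum_splitBdry_inr]
      rcases s with s | s
      · simp only [splitSrc_inr, splitTgt_inr, ite_and, Finset.sum_ite_eq', Finset.mem_univ,
          if_true, splitBdry_inr_inl, if_false, Finset.sum_const_zero, zero_add, splitWtEnd,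
          splitDirEnd, starWt, starDir, zero_smul, add_zero]
        by_cases h1 : Γ.src s.1 = Γ.bdry i <;> by_cases h2 : Γ.tgt s.1 = Γ.bdry i
        · simp [dir_loop Γ (h1.trans h2.symm)]
        · simp [h1, h2]
        · simp [h1, h2]
        · exact absurd s.2 (by tauto)
      · simp only [splitSrc_inr_inr, splitTgt_inr_inr, splitBdry_inr_inr, Finset.sum_ite_eq',
          Finset.mem_univ, if_true, if_false, Finset.sum_const_zero, splitWtEnd,
          splitDirEnd, starWt, starDir, zero_smul, add_zero, smul_neg, add_neg_cancel]

/-- The constraints on the split curve: old non-compact edges keep their constraints, the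
extended edges carry the trivial constraint, and each new contracted edge carries the point
condition at the image of its vertex. -/
def splitConstraint (Γ : TropCurve N V C I) (i : I) (A : I → AffineSubspace ℝ (RealSpan N)) :
    Γ.SplitEnd i → AffineSubspace ℝ (RealSpan N)
  | Sum.inl j => A j.1
  | Sum.inr (Sum.inl _) => ⊤
  | Sum.inr (Sum.inr _) => AffineSubspace.mk' (Γ.pos (Γ.bdry i)) ⊥

end Split

end TropCurve

end TropicalSplit

end

/-! The two curves have the same compact edges with the same weights, so only the lattice indices
have to be compared. The two lattice maps have different sources and targets, and the comparison
takes place in the common group `R` of tuples in `N` indexed by the compact edges and by the ends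
other than `i`. Extension by zero followed by projection sends `R` to either target.

In both cases the image of `R` and the image of the lattice map together generate the target, so the
index is that of the preimage in `R` (`latticeIndex_eq_index_comap`). For `Γ`, a constant tuple of
positions accounts for the entry at `E_i`. For the split curve, each `V_E` carries its own
point-constrained end, so the positions of the `V_E` account for those entries, while the extended
ends contribute trivial quotients.

The two preimages coincide (`split_latticeIndex`). A tuple lies in the first iff it is realized by
positions with `V_i` at `0`, and in the second iff it is realized by positions with every `V_E` at
`0`. Both amount to the same choice of positions for the remaining vertices. -/

theorem AddSubgroup.index_comap_of_sup_range_eq_top {R P : Type*} [AddCommGroup R]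
    [AddCommGroup P] (K : AddSubgroup P) (σ : R →+ P) (h : K ⊔ σ.range = ⊤) :
    (K.comap σ).index = K.index := by
  -- The index of the preimage is the relative index of `K` in the range of `σ`, which equals that
  -- in `K ⊔ σ.range`. This includes infinite indices, recorded as `0`.
  rw [AddSubgroup.index_comap, ← AddSubgroup.relIndex_sup_right, sup_comm, h,
    AddSubgroup.relIndex_top_right]

namespace TropicalSplit

/-! ### Lattice spans of point constraints and trivial constraints -/

theorem latticeSpan_singleton {N : Type*} [AddCommGroup N] [Module.Free ℤ N] (p : RealSpan N) :
    latticeSpan ({p} : Set (RealSpan N)) = ⊥ := by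
  ext x
  rw [latticeSpan, vectorSpan_singleton, Submodule.mem_comap, Submodule.restrictScalars_mem,
    Submodule.mem_bot, Submodule.mem_bot]
  exact map_eq_zero_iff _ TropCurve.toReal_injective

theorem latticeSpan_univ {N : Type*} [AddCommGroup N] :
    latticeSpan (Set.univ : Set (RealSpan N)) = ⊤ := by
  ext x
  have h : vectorSpan ℝ (Set.univ : Set (RealSpan N)) = ⊤ :=
    eq_top_iff.mpr fun y _ => by
      simpa using vsub_mem_vectorSpan ℝ (Set.mem_univ y) (Set.mem_univ (0 : RealSpan N))
  simp [latticeSpan, h]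

/-! ### Lattice indices computed on lifts to tuples in `N` -/

namespace TropCurve

variable {N V C I : Type*} [AddCommGroup N] [DecidableEq V] [Fintype C] [Fintype I]

/-- The projection from tuples of lattice points to the codomain of the lattice map. -/
def latticeProj (Γ : TropCurve N V C I) (A : I → AffineSubspace ℝ (RealSpan N)) :
    ((C → N) × (I → N)) →ₗ[ℤ] (∀ e : C, N ⧸ latticeSpan (Γ.edgeImage e)) ×
      (∀ j : I, N ⧸ latticeSpan (A j : Set (RealSpan N))) :=
  LinearMap.prodMap
    (LinearMap.pi fun e => (latticeSpan (Γ.edgeImage e)).mkQ ∘ₗ LinearMap.proj e)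
    (LinearMap.pi fun j => (latticeSpan (A j : Set (RealSpan N))).mkQ ∘ₗ LinearMap.proj j)

/-- Trades equality in a product of quotients for membership of differences, so that later
computations stay inside `N`. -/
theorem latticeMap_eq_latticeProj_iff (Γ : TropCurve N V C I)
    (A : I → AffineSubspace ℝ (RealSpan N)) (H : V → N) (z : (C → N) × (I → N)) :
    Γ.latticeMap A H = Γ.latticeProj A z ↔
      (∀ e, H (Γ.tgt e) - H (Γ.src e) - z.1 e ∈ latticeSpan (Γ.edgeImage e)) ∧
      ∀ j, H (Γ.bdry j) - z.2 j ∈ latticeSpan (A j : Set (RealSpan N)) := by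
  rw [Prod.ext_iff, funext_iff, funext_iff]
  exact and_congr (forall_congr' fun e => Submodule.Quotient.eq _)
    (forall_congr' fun j => Submodule.Quotient.eq _)

theorem latticeProj_surjective (Γ : TropCurve N V C I)
    (A : I → AffineSubspace ℝ (RealSpan N)) : Function.Surjective (Γ.latticeProj A) := by
  rintro ⟨p, q⟩
  choose x hx using fun e => Submodule.mkQ_surjective _ (p e)
  choose y hy using fun j => Submodule.mkQ_surjective _ (q j)
  exact ⟨(x, y), Prod.ext (funext hx) (funext hy)⟩

/-- The lattice index can be computed in any group of tuples of lattice points that, together with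
the image of the lattice map, generates the codomain. -/
theorem latticeIndex_eq_index_comap (Γ : TropCurve N V C I)
    (A : I → AffineSubspace ℝ (RealSpan N)) {R : Type*} [AddCommGroup R]
    (ε : R →ₗ[ℤ] (C → N) × (I → N))
    (h : ∀ z, ∃ H r, Γ.latticeMap A H = Γ.latticeProj A (z - ε r)) :
    Γ.latticeIndex A = ((LinearMap.range (Γ.latticeMap A)).comap
      (Γ.latticeProj A ∘ₗ ε)).toAddSubgroup.index := by
  refine (AddSubgroup.index_comap_of_sup_range_eq_top _
    (Γ.latticeProj A ∘ₗ ε).toAddMonoidHom ?_).symm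
  refine eq_top_iff.mpr fun p _ => ?_
  -- By surjectivity of the projection, generation need only be checked on lifts `z`, where `h`
  -- supplies the decomposition.
  obtain ⟨z, rfl⟩ := Γ.latticeProj_surjective A p
  obtain ⟨H, r, hr⟩ := h z
  rw [map_sub] at hr
  rw [← sub_add_cancel (Γ.latticeProj A z) (Γ.latticeProj A (ε r)), ← hr]
  exact AddSubgroup.add_mem_sup ⟨H, rfl⟩ ⟨r, rfl⟩

/-! ### Preimages in the common group and their comparison -/

section Split

variable [DecidableEq I]

/-- Extension by zero at the non-compact edge `i`. -/
def extendByZero (i : I) :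
    ((C → N) × ({j : I // j ≠ i} → N)) →ₗ[ℤ] (C → N) × (I → N) where
  toFun z := (z.1, fun j => if h : j ≠ i then z.2 ⟨j, h⟩ else 0)
  map_add' z w := by
    refine Prod.ext rfl (funext fun j => ?_)
    by_cases h : j = i <;> simp [h]
  map_smul' c z := by
    refine Prod.ext rfl (funext fun j => ?_)
    by_cases h : j = i <;> simp [h]

theorem latticeMap_eq_extendByZero_iff (Γ : TropCurve N V C I)
    (A : I → AffineSubspace ℝ (RealSpan N)) (i : I)
    (hA : latticeSpan (A i : Set (RealSpan N)) = ⊥) (H : V → N)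
    (z : (C → N) × ({j : I // j ≠ i} → N)) :
    Γ.latticeMap A H = Γ.latticeProj A (extendByZero (N := N) (C := C) i z) ↔
      (∀ e, H (Γ.tgt e) - H (Γ.src e) - z.1 e ∈ latticeSpan (Γ.edgeImage e)) ∧
      (∀ j : {j : I // j ≠ i},
        H (Γ.bdry j.1) - z.2 j ∈ latticeSpan (A j.1 : Set (RealSpan N))) ∧
      H (Γ.bdry i) = 0 := by
  rw [latticeMap_eq_latticeProj_iff]
  refine and_congr Iff.rfl ⟨fun h => ⟨fun j => ?_, ?_⟩, fun h j => ?_⟩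
  · simpa [extendByZero, j.2] using h j.1
  · simpa [extendByZero, hA] using h i
  · by_cases hj : j = i
    · subst hj
      simp [extendByZero, h.2]
    · simpa [extendByZero, hj] using h.1 ⟨j, hj⟩

theorem latticeIndex_eq_index_comap_extendByZero (Γ : TropCurve N V C I)
    (A : I → AffineSubspace ℝ (RealSpan N)) (i : I) :
    Γ.latticeIndex A = ((LinearMap.range (Γ.latticeMap A)).comap
      (Γ.latticeProj A ∘ₗ extendByZero i)).toAddSubgroup.index := by
  refine Γ.latticeIndex_eq_index_comap A _ fun z =>
    -- A global translation by `z.2 i` is invisible to the edge differences and shifts every end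
    -- entry equally, so subtracting it clears the entry at `i`.
    ⟨fun _ => z.2 i, (z.1, fun j => z.2 j.1 - z.2 i), ?_⟩
  rw [latticeMap_eq_latticeProj_iff]
  refine ⟨fun e => by simp [extendByZero], fun j => ?_⟩
  by_cases hj : j = i <;> simp [extendByZero, hj]

/-- Extension by zero at the new non-compact edges of the split curve. -/
def splitExtendByZero (Γ : TropCurve N V C I) (i : I) :
    ((C → N) × ({j : I // j ≠ i} → N)) →ₗ[ℤ] (C → N) × (Γ.SplitEnd i → N) where
  toFun z := (z.1, Sum.elim z.2 0)
  map_add' z w := by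
    refine Prod.ext rfl (funext fun j => ?_)
    rcases j with j | j <;> simp
  map_smul' c z := by
    refine Prod.ext rfl (funext fun j => ?_)
    rcases j with j | j <;> simp

variable [Module.Free ℤ N] [DecidableEq C]

theorem split_edgeImage (Γ : TropCurve N V C I) (i : I) (e : C) :
    (Γ.split i).edgeImage e = Γ.edgeImage e :=
  congrArg₂ (segment ℝ) (Γ.splitPos_src i e) (Γ.splitPos_tgt i e)

/-- The extended ends impose nothing, since their quotient is `N / N`. A point has zero lattice
span, so the end `E°` forces the position of `V_E` to vanish exactly. -/
theorem split_latticeMap_eq_splitExtendByZero_iff (Γ : TropCurve N V C I)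
    (A : I → AffineSubspace ℝ (RealSpan N)) (i : I) (H : Γ.SplitVertex i → N)
    (z : (C → N) × ({j : I // j ≠ i} → N)) :
    (Γ.split i).latticeMap (Γ.splitConstraint i A) H
        = (Γ.split i).latticeProj (Γ.splitConstraint i A) (Γ.splitExtendByZero i z) ↔
      (∀ e, H (Γ.splitTgt i e) - H (Γ.splitSrc i e) - z.1 e ∈ latticeSpan (Γ.edgeImage e)) ∧
      (∀ j : {j : I // j ≠ i}, H (Γ.splitBdry i (Sum.inl j)) - z.2 j
        ∈ latticeSpan (A j.1 : Set (RealSpan N))) ∧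
      ∀ s, H (Sum.inr s) = 0 := by
  rw [latticeMap_eq_latticeProj_iff]
  refine and_congr (forall_congr' fun e => by rw [split_edgeImage]; rfl)
    ⟨fun h => ⟨fun j => h (Sum.inl j), fun s => ?_⟩, ?_⟩
  · have hs := h (Sum.inr (Sum.inr s))
    have h0 : ((AffineSubspace.mk' (Γ.pos (Γ.bdry i)) ⊥ : AffineSubspace ℝ (RealSpan N)) :
        Set (RealSpan N)) = {Γ.pos (Γ.bdry i)} := by
      ext x
      simp [AffineSubspace.mem_mk', sub_eq_zero]
    simpa [splitConstraint, h0, latticeSpan_singleton, splitExtendByZero, split, splitBdry] using hs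
  · rintro ⟨h1, h2⟩ (j | s | s)
    · exact h1 j
    · simp [splitConstraint, latticeSpan_univ]
    · simp [splitExtendByZero, split, splitBdry, h2]

theorem split_latticeIndex_eq_index_comap_splitExtendByZero (Γ : TropCurve N V C I)
    (A : I → AffineSubspace ℝ (RealSpan N)) (i : I) :
    (Γ.split i).latticeIndex (Γ.splitConstraint i A) =
      ((LinearMap.range ((Γ.split i).latticeMap (Γ.splitConstraint i A))).comap
        ((Γ.split i).latticeProj (Γ.splitConstraint i A) ∘ₗ
          Γ.splitExtendByZero i)).toAddSubgroup.index := by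
  refine (Γ.split i).latticeIndex_eq_index_comap _ _ fun z => ?_
  -- Each `V_E` takes the value prescribed at its own `E°`. The resulting changes at compact edges
  -- and old ends are absorbed by the element of the common group.
  let H : Γ.SplitVertex i → N := Sum.elim 0 fun s => z.2 (Sum.inr (Sum.inr s))
  refine ⟨H, (fun e => z.1 e - (H (Γ.splitTgt i e) - H (Γ.splitSrc i e)),
    fun j => z.2 (Sum.inl j) - H (Γ.splitBdry i (Sum.inl j))), ?_⟩
  rw [latticeMap_eq_latticeProj_iff]
  refine ⟨fun e => by simp [splitExtendByZero, split], ?_⟩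
  rintro (j | s | s)
  · simp [splitExtendByZero, split]
  · simp [splitConstraint, latticeSpan_univ]
  · simp [splitExtendByZero, split, splitBdry, H]

theorem split_latticeIndex (Γ : TropCurve N V C I) (A : I → AffineSubspace ℝ (RealSpan N))
    (i : I) (hA : latticeSpan (A i : Set (RealSpan N)) = ⊥) :
    (Γ.split i).latticeIndex (Γ.splitConstraint i A) = Γ.latticeIndex A := by
  rw [latticeIndex_eq_index_comap_extendByZero Γ A i,
    split_latticeIndex_eq_index_comap_splitExtendByZero]
  congr 2
  ext z
  simp only [Submodule.mem_comap, LinearMap.mem_range, LinearMap.comp_apply,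
    latticeMap_eq_extendByZero_iff Γ A i hA, split_latticeMap_eq_splitExtendByZero_iff]
  -- Both sides describe positions of the old vertices, extended by zero to the others.
  have key : ∀ (H : V → N) (H' : Γ.SplitVertex i → N), H (Γ.bdry i) = 0 →
      (∀ s, H' (Sum.inr s) = 0) → (∀ v, H' (Sum.inl v) = H v.1) →
      (∀ e, H' (Γ.splitSrc i e) = H (Γ.src e)) ∧ (∀ e, H' (Γ.splitTgt i e) = H (Γ.tgt e)) ∧
      ∀ j, H' (Γ.splitBdry i (Sum.inl j)) = H (Γ.bdry j.1) := by
    intro H H' h0 h1 h2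
    refine ⟨fun e => ?_, fun e => ?_, fun j => ?_⟩
    · unfold splitSrc
      split_ifs with h
      · rw [h1, h, h0]
      · rw [h2]
    · unfold splitTgt
      split_ifs with h
      · rw [h1, h, h0]
      · rw [h2]
    · simp only [splitBdry]
      split_ifs with h
      · rw [h1, h, h0]
      · rw [h2]
  constructor
  · rintro ⟨H', hC, hI, h0⟩
    -- All the `V_E` are merged back into `V_i`, which is consistent because `H'` vanishes at each
    -- of them.
    let H : V → N := fun v => if h : v = Γ.bdry i then 0 else H' (Sum.inl ⟨v, h⟩)
    have hH : H (Γ.bdry i) = 0 := by simp [H]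
    obtain ⟨k1, k2, k3⟩ := key H H' hH h0 fun v => by simp [H, v.2]
    simp only [k1, k2, k3] at hC hI
    exact ⟨H, hC, hI, hH⟩
  · rintro ⟨H, hC, hI, h0⟩
    obtain ⟨k1, k2, k3⟩ := key H (Sum.elim (fun v => H v.1) 0) h0 (fun _ => rfl) fun _ => rfl
    refine ⟨Sum.elim (fun v => H v.1) 0, ?_, ?_, fun _ => rfl⟩
    · simpa only [k1, k2] using hC
    · simpa only [k3] using hI

end Split

end TropCurve

end TropicalSplit

theorem mainTheorem8 {N : Type*} [AddCommGroup N] [Module.Free ℤ N] [Module.Finite ℤ N]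
    {V C I : Type*} [Fintype V] [Fintype C] [Fintype I]
    [DecidableEq V] [DecidableEq C] [DecidableEq I]
    (Γ : TropicalSplit.TropCurve N V C I) (g : ℕ) (Δ : I → N)
    (A : I → AffineSubspace ℝ (TropicalSplit.RealSpan N)) (Ψ : {j : I // Γ.wtEnd j = 0} → ℕ)
    (hrigid : Γ.IsRigid g Δ A Ψ)
    (i : I) (hi : Γ.wtEnd i = 0)
    (hpt : ∃ p, (A i : Set (TropicalSplit.RealSpan N)) = {p}) :
    Γ.mult A = (Γ.split i).mult (Γ.splitConstraint i A) := by
  obtain ⟨p, hp⟩ := hpt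
  unfold TropicalSplit.TropCurve.mult
  rw [Γ.split_latticeIndex A i (by rw [hp, TropicalSplit.latticeSpan_singleton])]
  -- The splitting leaves `C` and `wt` untouched, so the weight products agree by definition.
  rfl
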